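/- For a partition $\lambda$ let $s_\lambda$ denote the Schur function in infinitely many variables, and write $(2^a,1^b)$ for the partition with $a$ parts equal to $2$ and $b$ parts equal to $1$; by convention $s_{(2^a,1^b)}=0$ for $a<0$. For integers $m\ge 1$ and $0\le i\le m$ put $$D_{m,i}=s_{(2^{i})}\,s_{(2^{m-i-1})}+s_{(2^{i-1},1^2)}\,s_{(2^{m-i-1})}-s_{(2^{i-1},1)}\,s_{(2^{m-i-1},1)}.$$ A symmetric function $f$ is called Schur positive (respectively Schur negative) if all the coefficients $a_\lambda$ in its expansion $f=\sum_\lambda a_\lambda s_\lambda$ into Schur functions are nonnegative (respectively nonpositive). Let $k\ge 1$. (i) If $m=2k+1$, then $D_{m,i}$ is Schur positive for $0\le i\le k$, and $D_{m,i}$ is Schur negative for $k+1\le i\le m-1$. (ii) If $m=2k$, then $D_{m,i}$ is Schur positive for $0\le i\le k-1$, and $D_{m,i}$ is Schur negative for $k\le i\le m-1$. -/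

import Mathlib

/-- The exponent vector `type(T)` of a semistandard Young tableau `T`: its value at `n` is the
number of cells of `T` containing the entry `n`. (In Mathlib the entries are natural numbers
starting at `0`, so the variables below are `x 0, x 1, x 2, …`.) -/
noncomputable def SemistandardYoungTableau.type {μ : YoungDiagram} (T : SemistandardYoungTableau μ) : ℕ →₀ ℕ :=
  ∑ c ∈ μ.cells, Finsupp.single (T c.1 c.2) 1

/-- Only finitely many tableaux of a given shape have a given type, so that the cardinalities in
the definition of Schur functions are genuine. -/
theorem SemistandardYoungTableau.finite_type_eq (μ : YoungDiagram) (d : ℕ →₀ ℕ) :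
    Finite {T : SemistandardYoungTableau μ // T.type = d} := by
  have key : ∀ T : {T : SemistandardYoungTableau μ // T.type = d}, ∀ c : μ.cells,
      T.1 c.1.1 c.1.2 ∈ d.support := by
    rintro ⟨T, rfl⟩ ⟨c, hc⟩
    change T (c.1) (c.2) ∈ T.type.support
    rw [Finsupp.mem_support_iff]
    intro h0
    rw [SemistandardYoungTableau.type, Finsupp.finsetSum_apply, Finset.sum_eq_zero_iff] at h0
    simpa using h0 c hc
  let f : {T : SemistandardYoungTableau μ // T.type = d} → (μ.cells → d.support) :=
    fun T c => ⟨T.1 c.1.1 c.1.2, key T c⟩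
  refine Finite.of_injective f ?_
  intro T T' h
  apply Subtype.ext
  apply SemistandardYoungTableau.ext
  intro i j
  by_cases hc : (i, j) ∈ μ
  · exact congrArg Subtype.val (congrFun h ⟨(i, j), hc⟩)
  · rw [T.1.zeros hc, T'.1.zeros hc]

/-- The Schur function `s_μ = ∑_T x^T` in the infinitely many variables `x 0, x 1, x 2, …`, the sum
being over all semistandard Young tableaux `T` of shape `μ`: the coefficient of the monomial `x^d`
is the number of such tableaux of type `d`. -/
noncomputable def schurFunction (μ : YoungDiagram) : MvPowerSeries ℕ ℤ :=
  fun d => (Nat.card {T : SemistandardYoungTableau μ // T.type = d} : ℤ)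

/-- The partition `(2^a, 1^b)`. -/
def twoColumnShape (a b : ℕ) : YoungDiagram :=
  YoungDiagram.ofRowLens (List.replicate a 2 ++ List.replicate b 1) (by
    apply List.Pairwise.sortedGE
    rw [List.pairwise_append]
    refine ⟨List.pairwise_replicate.2 (Or.inr le_rfl), List.pairwise_replicate.2 (Or.inr le_rfl), ?_⟩
    intro x hx y hy
    rw [List.eq_of_mem_replicate hx, List.eq_of_mem_replicate hy]
    norm_num)

/-- The Schur function `s_{(2^a, 1^b)}`, with the convention that it is `0` for `a < 0`. -/
noncomputable def schurTwoColumn (a : ℤ) (b : ℕ) : MvPowerSeries ℕ ℤ :=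
  if 0 ≤ a then schurFunction (twoColumnShape a.toNat b) else 0

/-- `D_{m,i} = s_{(2^i)} s_{(2^{m-i-1})} + s_{(2^{i-1},1^2)} s_{(2^{m-i-1})}
- s_{(2^{i-1},1)} s_{(2^{m-i-1},1)}`. -/
noncomputable def schurD (m i : ℕ) : MvPowerSeries ℕ ℤ :=
  schurTwoColumn (i : ℤ) 0 * schurTwoColumn ((m : ℤ) - i - 1) 0
    + schurTwoColumn ((i : ℤ) - 1) 2 * schurTwoColumn ((m : ℤ) - i - 1) 0
    - schurTwoColumn ((i : ℤ) - 1) 1 * schurTwoColumn ((m : ℤ) - i - 1) 1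

/-- `f = ∑_μ a_μ s_μ`, a finite linear combination of Schur functions. -/
def IsSchurExpansion (f : MvPowerSeries ℕ ℤ) (a : YoungDiagram →₀ ℤ) : Prop :=
  f = a.sum (fun μ c => c • schurFunction μ)

/-- `f` is a linear combination of Schur functions with nonnegative coefficients. -/
def IsSchurPositive (f : MvPowerSeries ℕ ℤ) : Prop :=
  ∃ a : YoungDiagram →₀ ℤ, IsSchurExpansion f a ∧ ∀ μ, 0 ≤ a μ

/-- `f` is a linear combination of Schur functions with nonpositive coefficients. -/
def IsSchurNegative (f : MvPowerSeries ℕ ℤ) : Prop :=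
  ∃ a : YoungDiagram →₀ ℤ, IsSchurExpansion f a ∧ ∀ μ, a μ ≤ 0

/-! ### Polynomial identities between minors of a Toeplitz array `e` -/

section ElementaryDeterminants

variable {R : Type*} [CommRing R]

/-! Put j = m - i - 1. By the dual Jacobi–Trudi formula (`boundedSchur_colShape`), a Schur function
is a determinant in the elementary symmetric functions, indexed by column lengths. So D is a quartic
polynomial in the e_t, and its expected constituents, with at most four columns, are 4×4
determinants. Shifting one unit from the last to the first row index makes these determinants
telescope (`minorFour_eq_sub`, `sum_minorFour`). D is a sum of two primitives, and so is -D
(`minorD_eq_primitive`, `neg_minorD_eq_primitive`). This writes D, and separately -D, as a sum of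
4×4 determinants with coefficient 1. For i ≤ j every index sequence in the sum for D is a partition,
or else two rows coincide and the term vanishes; for j < i the same holds for -D. Determinants are
compared with tableaux in finitely many variables, which suffices coefficientwise
(`AgreeBelow.eq_of_forall`). -/

/-- The two-row determinant `e_a e_b - e_{a+1} e_{b-1}`. -/
def minorTwo (e : ℤ → R) (a b : ℤ) : R := e a * e b - e (a + 1) * e (b - 1)

/-- The determinant `det (e_{α_i - i + j})` for `α = (a, b, c, d)`. -/
def minorFour (e : ℤ → R) (a b c d : ℤ) : R :=
  Matrix.det !![e a, e (a + 1), e (a + 2), e (a + 3);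
    e (b - 1), e b, e (b + 1), e (b + 2);
    e (c - 2), e (c - 1), e c, e (c + 1);
    e (d - 3), e (d - 2), e (d - 1), e d]

/-- The antiderivative in `a` of `minorFour e (u + a) q p (v - a)`, obtained by Laplace expansion
along the first and last rows. -/
def minorPrimitive (e : ℤ → R) (u q p v : ℤ) : R :=
  -(e q * e (p + 1) - e (q + 2) * e (p - 1)) * (e u * e (v - 1) + e (u + 1) * e (v - 2))
  + (e (q - 1) * e (p - 1) - e q * e (p - 2)) * (e (u + 2) * e v)
  - (e (q - 1) * e p - e (q + 1) * e (p - 2)) * (e (u + 1) * e v + e (u + 2) * e (v - 1))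
  + (e (q - 1) * e (p + 1) - e (q + 2) * e (p - 2)) * (e (u + 1) * e (v - 1))
  + (e q * e p - e (q + 1) * e (p - 1)) * (e u * e v + e (u + 1) * e (v - 1) + e (u + 2) * e (v - 2))
  + (e (q + 1) * e (p + 1) - e (q + 2) * e p) * (e u * e (v - 2))

/-- In the Laplace expansion, columns r < s of the outer rows contribute e_{u+r} e_{v-3+s} - e_{u+s}
e_{v-3+r}. The second product is the first after s - r shifts (u, v) ↦ (u+1, v-1), so the difference
is a telescoping sum of s - r terms; these are the factors collected in `minorPrimitive`. -/
theorem minorFour_eq_sub (e : ℤ → R) (u q p v : ℤ) :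
    minorFour e u q p v = minorPrimitive e u q p v - minorPrimitive e (u + 1) q p (v - 1) := by
  simp [minorFour, minorPrimitive, Matrix.det_succ_row_zero, Fin.sum_univ_succ, Fin.succAbove]
  ring_nf

theorem minorPrimitive_eq_zero {e : ℤ → R} (he : ∀ t < 0, e t = 0) (u q p : ℤ) {v : ℤ}
    (hv : v < 0) : minorPrimitive e u q p v = 0 := by
  simp [minorPrimitive, he v hv, he (v - 1) (by lia), he (v - 2) (by lia)]

/-- The sum telescopes, and the far end vanishes because its last index is -1. -/
theorem sum_minorFour {e : ℤ → R} (he : ∀ t < 0, e t = 0) (u q p : ℤ) (n : ℕ) :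
    ∑ a ∈ Finset.range n, minorFour e (u + a) q p ((n : ℤ) - 1 - a) =
      minorPrimitive e u q p ((n : ℤ) - 1) := by
  induction n generalizing u with
  | zero => simp [minorPrimitive_eq_zero he]
  | succ n ih =>
    have h : ∀ a : ℕ, minorFour e (u + (a + 1 : ℕ)) q p (((n + 1 : ℕ) : ℤ) - 1 - (a + 1 : ℕ)) =
        minorFour e (u + 1 + a) q p ((n : ℤ) - 1 - a) := fun a => by
      congr 1 <;> push_cast <;> ring
    simp only [Finset.sum_range_succ', h, ih]
    push_cast
    simp only [add_sub_cancel_right, sub_zero, add_zero]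
    rw [minorFour_eq_sub, add_sub_cancel]

/-- The combination of products of two-row determinants underlying `schurD`. -/
def minorD (e : ℤ → R) (i j : ℤ) : R :=
  minorTwo e i i * minorTwo e j j + minorTwo e (i + 1) (i - 1) * minorTwo e j j
    - minorTwo e i (i - 1) * minorTwo e (j + 1) j

theorem minorD_eq_primitive (e : ℤ → R) (i j : ℤ) :
    minorD e i j = minorPrimitive e j j i i + minorPrimitive e j j (i + 1) (i - 1) := by
  simp only [minorD, minorTwo, minorPrimitive]
  ring_nf

theorem neg_minorD_eq_primitive (e : ℤ → R) (i j : ℤ) :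
    -minorD e i j =
      minorPrimitive e i (i - 1) (j + 1) j + minorPrimitive e i i (j + 1) (j - 1) := by
  simp only [minorD, minorTwo, minorPrimitive]
  ring_nf

theorem minorD_eq_sum {e : ℤ → R} (he : ∀ t < 0, e t = 0) (i j : ℕ) :
    minorD e i j = ∑ a ∈ Finset.range (i + 1), minorFour e (j + a) j i (i - a)
      + ∑ a ∈ Finset.range i, minorFour e (j + a) j (i + 1) (i - 1 - a) := by
  have h := sum_minorFour he j j i (i + 1)
  push_cast [add_sub_cancel_right] at h
  rw [minorD_eq_primitive, sum_minorFour he, h]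

theorem neg_minorD_eq_sum {e : ℤ → R} (he : ∀ t < 0, e t = 0) (i j : ℕ) :
    -minorD e i j = ∑ b ∈ Finset.range (j + 1), minorFour e (i + b) (i - 1) (j + 1) (j - b)
      + ∑ b ∈ Finset.range j, minorFour e (i + b) i (j + 1) (j - 1 - b) := by
  have h := sum_minorFour he i (i - 1) (j + 1) (j + 1)
  push_cast [add_sub_cancel_right] at h
  rw [neg_minorD_eq_primitive, sum_minorFour he, h]

/-- The two middle rows coincide. This disposes of the boundary cases i = j and i = j + 1, where the
index sequence is not a partition. -/
theorem minorFour_self_succ (e : ℤ → R) (a b d : ℤ) : minorFour e a b (b + 1) d = 0 := by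
  apply Matrix.det_zero_of_row_eq (i := 1) (j := 2) (by decide)
  ext x
  fin_cases x <;> simp <;> ring_nf

end ElementaryDeterminants

/-! ### Jacobi–Trudi determinants and Schur polynomials in finitely many variables -/

section DualJacobiTrudi

open Finset

/-- The elementary symmetric polynomials `e_t` in the variables `x 0, …, x (n - 1)`, for all
integers `t`. -/
noncomputable def elemSymm : ℕ → ℤ → MvPowerSeries ℕ ℤ
  | 0, t => if t = 0 then 1 else 0
  | n + 1, t => elemSymm n t + MvPowerSeries.X n * elemSymm n (t - 1)

theorem elemSymm_of_neg (n : ℕ) : ∀ t < 0, elemSymm n t = 0 := by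
  induction n with
  | zero => intro t ht; simp [elemSymm, ht.ne]
  | succ n ih => intro t ht; simp [elemSymm, ih t ht, ih (t - 1) (by lia)]

/-- The determinant `det (e_{c_i - i + j})` in the variables `x 0, …, x (n - 1)`. -/
noncomputable def jacobiTrudi (n : ℕ) {k : ℕ} (c : Fin k → ℤ) : MvPowerSeries ℕ ℤ :=
  Matrix.det (Matrix.of fun i j : Fin k => elemSymm n (c i - i + j))

/-- The indicator function of `s`. -/
def stripIndicator {k : ℕ} (s : Finset (Fin k)) (j : Fin k) : ℕ := if j ∈ s then 1 else 0

/-- The recursion for e_t splits each row in two; multilinearity expands the determinant over the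
set `s` of rows taking the part with `X n`. -/
theorem jacobiTrudi_succ (n : ℕ) {k : ℕ} (c : Fin k → ℤ) :
    jacobiTrudi (n + 1) c = ∑ s : Finset (Fin k),
      MvPowerSeries.X n ^ s.card * jacobiTrudi n (fun j => c j - stripIndicator s j) := by
  let f := (Matrix.detRowAlternating (n := Fin k) (R := MvPowerSeries ℕ ℤ)).toMultilinearMap
  let A : Fin k → Fin k → MvPowerSeries ℕ ℤ := fun i j => elemSymm n (c i - i + j)
  let B : Fin k → Fin k → MvPowerSeries ℕ ℤ := fun i j => elemSymm n (c i - 1 - i + j)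
  have h1 : jacobiTrudi (n + 1) c =
      f ((fun i => (MvPowerSeries.X n : MvPowerSeries ℕ ℤ) • B i) + A) := by
    change Matrix.det _ = Matrix.det _
    congr 1
    ext1 i j
    simp only [Matrix.of_apply, elemSymm, Pi.add_apply, Pi.smul_apply, smul_eq_mul, A, B]
    rw [add_comm]
    congr 3
    ring
  rw [h1, MultilinearMap.map_add_univ]
  refine sum_congr rfl fun s _ => ?_
  have h2 : s.piecewise (fun i => (MvPowerSeries.X n : MvPowerSeries ℕ ℤ) • B i) A =
      s.piecewise (fun i => (MvPowerSeries.X n : MvPowerSeries ℕ ℤ) • s.piecewise B A i)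
        (s.piecewise B A) := by
    ext1 i
    by_cases hi : i ∈ s <;> simp [hi]
  rw [h2, MultilinearMap.map_piecewise_smul, prod_const, smul_eq_mul]
  congr 1
  change Matrix.det _ = Matrix.det _
  congr 1
  ext1 i j
  by_cases hi : i ∈ s <;> simp [hi, A, B, stripIndicator]

/-- The last index is then negative too, and no index in the last row exceeds it, so that row is
zero. -/
theorem jacobiTrudi_eq_zero_of_neg (n : ℕ) {k : ℕ} {c : Fin k → ℤ} (hc : Antitone c) {j : Fin k}
    (hj : c j < 0) : jacobiTrudi n c = 0 := by
  obtain _ | k := k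
  · exact j.elim0
  refine Matrix.det_eq_zero_of_row_eq_zero (Fin.last k) fun i => ?_
  have h := hc (Fin.le_last j)
  rw [Matrix.of_apply]
  apply elemSymm_of_neg
  have := i.is_le
  simp only [Fin.val_last]
  lia

/-- Lowering entries by 0 or 1 can break monotonicity only at two equal neighbours of which just the
first is lowered; their rows then coincide. -/
theorem jacobiTrudi_eq_zero_of_not_antitone (n : ℕ) {k : ℕ} {c : Fin k → ℤ} (hc : Antitone c)
    {s : Finset (Fin k)} (hs : ¬ Antitone fun j => c j - stripIndicator s j) :
    jacobiTrudi n (fun j => c j - stripIndicator s j) = 0 := by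
  obtain _ | k := k
  · exact (hs fun i => i.elim0).elim
  rw [Fin.antitone_iff_succ_le] at hs
  push Not at hs
  obtain ⟨i, hi⟩ := hs
  refine Matrix.det_zero_of_row_eq (i := i.castSucc) (j := i.succ) (Fin.castSucc_lt_succ).ne ?_
  have h := hc (Fin.castSucc_lt_succ (i := i)).le
  have h' : c i.succ - stripIndicator s i.succ = c i.castSucc - stripIndicator s i.castSucc + 1 := by
    simp only [stripIndicator] at hi ⊢
    split_ifs at hi ⊢ <;> push_cast at hi ⊢ <;> lia
  ext1 j
  simp only [Matrix.of_apply]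
  rw [h']
  congr 1
  simp

theorem jacobiTrudi_zero {k : ℕ} {c : Fin k → ℕ} (hc : Antitone c) :
    jacobiTrudi 0 (fun j => (c j : ℤ)) = if ∀ j, c j = 0 then 1 else 0 := by
  split_ifs with h
  · rw [jacobiTrudi, ← Matrix.det_one (n := Fin k)]
    congr 1
    ext1 i j
    have : ((c i : ℤ) - i + j = 0) ↔ i = j := by rw [h, Fin.ext_iff]; lia
    simp [elemSymm, this, Matrix.one_apply]
  · push Not at h
    obtain ⟨j, hj⟩ := h
    obtain _ | k := k
    · exact j.elim0
    refine Matrix.det_eq_zero_of_row_eq_zero 0 fun i => ?_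
    have := hc (Fin.zero_le j)
    rw [Matrix.of_apply, elemSymm, if_neg]
    simp only [Fin.val_zero]
    lia

/-- The Young diagram with at most `k` columns whose column lengths are `c`, if `c` is
antitone. -/
def colShape {k : ℕ} (c : Fin k → ℕ) : YoungDiagram where
  -- Testing all columns up to `p.2` gives a lower set for arbitrary `c`; the bound `∑ j, c j` only
  -- serves finiteness.
  cells := ((range (∑ j, c j)) ×ˢ range k).filter fun p => ∀ j : Fin k, j.1 ≤ p.2 → p.1 < c j
  isLowerSet := by
    rintro ⟨a, b⟩ ⟨a', b'⟩ ⟨h1, h2⟩ h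
    simp only [coe_filter, mem_product, mem_range, Set.mem_ofPred_eq] at h h1 h2 ⊢
    exact ⟨⟨by lia, by lia⟩, fun j hj => lt_of_le_of_lt h1 (h.2 j (hj.trans h2))⟩

theorem mem_colShape {k : ℕ} {c : Fin k → ℕ} (hc : Antitone c) {p : ℕ × ℕ} :
    p ∈ colShape c ↔ ∃ h : p.2 < k, p.1 < c ⟨p.2, h⟩ := by
  rw [← YoungDiagram.mem_cells]
  simp only [colShape, mem_filter, mem_product, mem_range]
  constructor
  · rintro ⟨⟨-, h⟩, h'⟩
    exact ⟨h, h' ⟨_, h⟩ le_rfl⟩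
  · rintro ⟨h, h'⟩
    exact ⟨⟨h'.trans_le (single_le_sum (f := c) (by simp) (mem_univ _)), h⟩,
      fun j hj => h'.trans_le (hc hj)⟩

theorem mk_mem_colShape {k : ℕ} {c : Fin k → ℕ} (hc : Antitone c) {i : ℕ} {j : Fin k} :
    (i, (j : ℕ)) ∈ colShape c ↔ i < c j := by
  simp [mem_colShape hc]

/-- The semistandard Young tableaux all of whose entries are less than `n`. -/
abbrev BoundedTableau (n : ℕ) (μ : YoungDiagram) : Type :=
  {T : SemistandardYoungTableau μ // ∀ p ∈ μ.cells, T p.1 p.2 < n}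

instance (n : ℕ) (μ : YoungDiagram) : Finite (BoundedTableau n μ) := by
  let f : BoundedTableau n μ → (μ.cells → Fin n) := fun T p => ⟨T.1 p.1.1 p.1.2, T.2 _ p.2⟩
  refine Finite.of_injective f fun T T' h => Subtype.ext <| SemistandardYoungTableau.ext fun i j => ?_
  by_cases hc : (i, j) ∈ μ
  · exact congrArg Fin.val (congrFun h ⟨(i, j), hc⟩)
  · rw [T.1.zeros hc, T'.1.zeros hc]

noncomputable instance (n : ℕ) (μ : YoungDiagram) : Fintype (BoundedTableau n μ) :=
  Fintype.ofFinite _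

/-- The Schur polynomial of shape `μ` in the variables `x 0, …, x (n - 1)`. -/
noncomputable def boundedSchur (n : ℕ) (μ : YoungDiagram) : MvPowerSeries ℕ ℤ :=
  ∑ T : BoundedTableau n μ, MvPowerSeries.monomial T.1.type 1

theorem coeff_boundedSchur {n : ℕ} (μ : YoungDiagram) {d : ℕ →₀ ℕ} (hd : ∀ t ∈ d.support, t < n) :
    MvPowerSeries.coeff d (boundedSchur n μ) = MvPowerSeries.coeff d (schurFunction μ) := by
  classical
  simp only [boundedSchur, map_sum, MvPowerSeries.coeff_monomial, sum_boole]
  change _ = (Nat.card {T : SemistandardYoungTableau μ // T.type = d} : ℤ)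
  have bound : ∀ T : SemistandardYoungTableau μ, T.type = d → ∀ p ∈ μ.cells, T p.1 p.2 < n := by
    rintro T rfl p hp
    apply hd
    rw [Finsupp.mem_support_iff, SemistandardYoungTableau.type, Finsupp.finsetSum_apply]
    intro h
    rw [sum_eq_zero_iff] at h
    simpa using h p hp
  rw [← Fintype.card_subtype, ← Nat.card_eq_fintype_card]
  congr 1
  exact Nat.card_congr ⟨fun T => ⟨T.1.1, T.2.symm⟩,
    fun T => ⟨⟨T.1, bound T.1 T.2⟩, T.2.symm⟩, fun _ => rfl, fun _ => rfl⟩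

theorem boundedSchur_zero {k : ℕ} {c : Fin k → ℕ} (hc : Antitone c) :
    boundedSchur 0 (colShape c) = if ∀ j, c j = 0 then 1 else 0 := by
  split_ifs with h
  · have hem : (colShape c).cells = ∅ := by
      ext p
      rw [YoungDiagram.mem_cells, mem_colShape hc]
      simp [h]
    have : Unique (BoundedTableau 0 (colShape c)) :=
      { default := ⟨SemistandardYoungTableau.highestWeight _, by simp [hem]⟩
        uniq := fun T => Subtype.ext <| SemistandardYoungTableau.ext fun i j => by
          have hp : (i, j) ∉ colShape c := by rw [← YoungDiagram.mem_cells, hem]; simp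
          rw [SemistandardYoungTableau.zeros _ hp, SemistandardYoungTableau.zeros _ hp] }
    have hty : ∀ T : SemistandardYoungTableau (colShape c), T.type = 0 := fun T => by
      simp [SemistandardYoungTableau.type, hem]
    rw [boundedSchur, Fintype.sum_unique, hty]
    rfl
  · push Not at h
    obtain ⟨j, hj⟩ := h
    have : IsEmpty (BoundedTableau 0 (colShape c)) :=
      ⟨fun T => absurd (T.2 (0, j) ((mk_mem_colShape hc).2 (by lia))) (by simp)⟩
    rw [boundedSchur, univ_eq_empty, sum_empty]

end DualJacobiTrudi

/-! ### Branching: removing the largest entry, and the dual Jacobi–Trudi formula -/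

section Branching

open Finset

variable {n k : ℕ} {c : Fin k → ℕ}

/-- The column lengths `c` with one cell removed from each column in `s`. -/
def removeStrip (c : Fin k → ℕ) (s : Finset (Fin k)) (j : Fin k) : ℕ := c j - stripIndicator s j

/-- Removing the bottom cells of the columns in `s` leaves a Young diagram. -/
def IsStrip (c : Fin k → ℕ) (s : Finset (Fin k)) : Prop :=
  (∀ j ∈ s, 0 < c j) ∧ Antitone (removeStrip c s)

/-- The columns of `T` with an entry equal to `n`. -/
def topColumns (n : ℕ) (c : Fin k → ℕ) (T : SemistandardYoungTableau (colShape c)) :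
    Finset (Fin k) :=
  univ.filter fun j => 0 < c j ∧ T (c j - 1) j = n

theorem removeStrip_le (c : Fin k → ℕ) (s : Finset (Fin k)) (j : Fin k) : removeStrip c s j ≤ c j :=
  Nat.sub_le _ _

theorem BoundedTableau.lt_succ (hc : Antitone c) (T : BoundedTableau (n + 1) (colShape c)) {i : ℕ}
    {j : Fin k} (h : i < c j) : T.1 i j < n + 1 :=
  T.2 (i, j) ((mk_mem_colShape hc).2 h)

/-- Otherwise two columns of equal length would have the entry `n` at the bottom of the left one
only, against weak increase along the row. -/
theorem isStrip_topColumns (hc : Antitone c) (T : BoundedTableau (n + 1) (colShape c)) :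
    IsStrip c (topColumns n c T.1) := by
  refine ⟨fun j hj => (mem_filter.1 hj).2.1, fun j₁ j₂ h => ?_⟩
  by_contra! hlt
  have h12 := hc h
  have h2 : j₂ ∉ topColumns n c T.1 ∧ j₁ ∈ topColumns n c T.1 ∧ c j₁ = c j₂ ∧ 0 < c j₂ := by
    simp only [removeStrip, stripIndicator] at hlt
    split_ifs at hlt <;> lia
  obtain ⟨h3, h4, h5, h6⟩ := h2
  refine h3 (mem_filter.2 ⟨mem_univ _, h6, ?_⟩)
  have h7 := T.1.row_weak_of_le (i := c j₂ - 1) h ((mk_mem_colShape hc).2 (by lia))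
  have h8 := T.lt_succ hc (show c j₂ - 1 < c j₂ by lia)
  have h9 := (mem_filter.1 h4).2.2
  rw [h5] at h9
  lia

/-- By strict increase down columns, the maximal entry `n` can only occupy the bottom cell. -/
theorem lt_iff_lt_removeStrip (hc : Antitone c) (T : BoundedTableau (n + 1) (colShape c)) {i : ℕ}
    {j : Fin k} (hi : i < c j) : T.1 i j < n ↔ i < removeStrip c (topColumns n c T.1) j := by
  have h0 : 0 < c j := by lia
  have hlast : (c j - 1, (j : ℕ)) ∈ colShape c := (mk_mem_colShape hc).2 (by lia)
  have hb := T.lt_succ hc (show c j - 1 < c j by lia)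
  have hw := T.1.col_weak (show i ≤ c j - 1 by lia) hlast
  by_cases hj : T.1 (c j - 1) j = n
  · have hr : removeStrip c (topColumns n c T.1) j = c j - 1 := by
      simp [removeStrip, stripIndicator, topColumns, hj, h0]
    rw [hr]
    constructor
    · intro h
      by_contra h'
      have : i = c j - 1 := by lia
      subst this
      lia
    · intro h
      have := T.1.col_strict h hlast
      lia
  · have hr : removeStrip c (topColumns n c T.1) j = c j := by
      simp [removeStrip, stripIndicator, topColumns, hj]
    rw [hr]
    exact ⟨fun _ => hi, fun _ => by lia⟩

theorem removeStrip_le_colShape (hc : Antitone c) {s : Finset (Fin k)}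
    (hs : Antitone (removeStrip c s)) : colShape (removeStrip c s) ≤ colShape c := by
  intro p hp
  obtain ⟨h, h'⟩ := (mem_colShape hs).1 hp
  exact (mem_colShape hc).2 ⟨h, h'.trans_le (removeStrip_le _ _ _)⟩

/-- The part of a tableau inside the smaller diagram `μ`. -/
def SemistandardYoungTableau.restrict {ν : YoungDiagram} (T : SemistandardYoungTableau ν)
    {μ : YoungDiagram} (h : μ ≤ ν) : SemistandardYoungTableau μ where
  entry i j := if (i, j) ∈ μ then T i j else 0
  row_weak' {i j₁ j₂} hj hm := by
    rw [if_pos hm, if_pos (μ.up_left_mem le_rfl hj.le hm)]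
    exact T.row_weak hj (h hm)
  col_strict' {i₁ i₂ j} hi hm := by
    rw [if_pos hm, if_pos (μ.up_left_mem hi.le le_rfl hm)]
    exact T.col_strict hi (h hm)
  zeros' h := if_neg h

theorem SemistandardYoungTableau.restrict_apply {μ ν : YoungDiagram} (T : SemistandardYoungTableau ν)
    (h : μ ≤ ν) (i j : ℕ) : T.restrict h i j = if (i, j) ∈ μ then T i j else 0 := rfl

theorem mem_sdiff_strip (hc : Antitone c) {s : Finset (Fin k)} (hs : IsStrip c s) {i : ℕ}
    {j : Fin k} : ((i, (j : ℕ)) ∈ colShape c ∧ (i, (j : ℕ)) ∉ colShape (removeStrip c s)) ↔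
      j ∈ s ∧ i = c j - 1 := by
  rw [mk_mem_colShape hc, mk_mem_colShape hs.2, removeStrip, stripIndicator]
  have := hs.1 j
  split_ifs with h <;> simp only [h, true_and, false_and, iff_false] at this ⊢ <;> grind

/-- Fill the strip `s` with the entry `n`. -/
def BoundedTableau.extend (hc : Antitone c) {s : Finset (Fin k)} (hs : IsStrip c s)
    (T : BoundedTableau n (colShape (removeStrip c s))) : BoundedTableau (n + 1) (colShape c) :=
  ⟨{ entry := fun i j => if (i, j) ∈ colShape (removeStrip c s) then T.1 i j else
        if (i, j) ∈ colShape c then n else 0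
     row_weak' := fun {i j₁ j₂} hj hm => by
      by_cases h2 : (i, j₂) ∈ colShape (removeStrip c s)
      · rw [if_pos h2, if_pos (YoungDiagram.up_left_mem _ le_rfl hj.le h2)]
        exact T.1.row_weak hj h2
      · rw [if_neg h2, if_pos hm]
        split_ifs with h3
        · exact (T.2 _ h3).le
        · exact le_rfl
        · exact Nat.zero_le _
     col_strict' := fun {i₁ i₂ j} hi hm => by
      by_cases h2 : (i₂, j) ∈ colShape (removeStrip c s)
      · rw [if_pos h2, if_pos (YoungDiagram.up_left_mem _ hi.le le_rfl h2)]
        exact T.1.col_strict hi h2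
      · rw [if_neg h2, if_pos hm]
        -- The strip has at most one cell per column, so the upper cell lies in the smaller diagram.
        have h1 : (i₁, j) ∈ colShape (removeStrip c s) := by
          by_contra h1
          obtain ⟨hk, -⟩ := (mem_colShape hc).1 hm
          have e2 := ((mem_sdiff_strip hc hs (i := i₂) (j := ⟨j, hk⟩)).1 ⟨hm, h2⟩).2
          have e1 := ((mem_sdiff_strip hc hs (i := i₁) (j := ⟨j, hk⟩)).1
            ⟨YoungDiagram.up_left_mem _ hi.le le_rfl hm, h1⟩).2
          lia
        rw [if_pos h1]
        exact T.2 _ h1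
     zeros' := fun h => by
      rw [if_neg fun h' => h (removeStrip_le_colShape hc hs.2 h'), if_neg h] },
    fun p hp => by
      change (if (p.1, p.2) ∈ _ then _ else _) < n + 1
      split_ifs with h
      · exact (T.2 _ h).trans (Nat.lt_succ_self n)
      · exact Nat.lt_succ_self n
      · exact Nat.succ_pos n⟩

theorem BoundedTableau.extend_apply (hc : Antitone c) {s : Finset (Fin k)} (hs : IsStrip c s)
    (T : BoundedTableau n (colShape (removeStrip c s))) (i j : ℕ) :
    (T.extend hc hs).1 i j = if (i, j) ∈ colShape (removeStrip c s) then T.1 i j else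
        if (i, j) ∈ colShape c then n else 0 := rfl

theorem BoundedTableau.topColumns_extend (hc : Antitone c) {s : Finset (Fin k)} (hs : IsStrip c s)
    (T : BoundedTableau n (colShape (removeStrip c s))) :
    topColumns n c (T.extend hc hs).1 = s := by
  ext j
  simp only [topColumns, mem_filter, mem_univ, true_and]
  constructor
  · rintro ⟨h0, h⟩
    rw [extend_apply] at h
    have h1 : (c j - 1, (j : ℕ)) ∉ colShape (removeStrip c s) := fun h1 => by
      rw [if_pos h1] at h
      exact (T.2 _ h1).ne h
    exact ((mem_sdiff_strip hc hs).1 ⟨(mk_mem_colShape hc).2 (by lia), h1⟩).1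
  · intro hj
    obtain ⟨h1, h2⟩ := (mem_sdiff_strip hc hs).2 ⟨hj, rfl⟩
    rw [extend_apply, if_neg h2, if_pos h1]
    exact ⟨hs.1 j hj, rfl⟩

theorem BoundedTableau.type_extend (hc : Antitone c) {s : Finset (Fin k)} (hs : IsStrip c s)
    (T : BoundedTableau n (colShape (removeStrip c s))) :
    (T.extend hc hs).1.type = Finsupp.single n s.card + T.1.type := by
  have hsub : (colShape (removeStrip c s)).cells ⊆ (colShape c).cells :=
    removeStrip_le_colShape hc hs.2
  rw [SemistandardYoungTableau.type, ← sum_sdiff hsub, SemistandardYoungTableau.type]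
  congr 1
  · have himg : (colShape c).cells \ (colShape (removeStrip c s)).cells =
        s.image fun j => (c j - 1, (j : ℕ)) := by
      ext ⟨i, j⟩
      simp only [mem_sdiff, YoungDiagram.mem_cells, mem_image, Prod.mk.injEq]
      constructor
      · rintro ⟨h1, h2⟩
        obtain ⟨hk, -⟩ := (mem_colShape hc).1 h1
        obtain ⟨h3, h4⟩ := (mem_sdiff_strip hc hs (j := ⟨j, hk⟩)).1 ⟨h1, h2⟩
        exact ⟨⟨j, hk⟩, h3, h4.symm, rfl⟩
      · rintro ⟨j, hj, rfl, rfl⟩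
        exact (mem_sdiff_strip hc hs).2 ⟨hj, rfl⟩
    rw [himg, sum_image (fun a _ b _ h => Fin.ext (Prod.ext_iff.1 h).2)]
    rw [sum_congr rfl (g := fun _ => Finsupp.single n 1)]
    · simp
    · intro j hj
      obtain ⟨h1, h2⟩ := (mem_sdiff_strip hc hs).2 ⟨hj, rfl⟩
      rw [extend_apply, if_neg h2, if_pos h1]
  · refine sum_congr rfl fun p hp => ?_
    rw [extend_apply, if_pos (show (p.1, p.2) ∈ colShape _ from hp)]

theorem BoundedTableau.restrict_lt (hc : Antitone c) (T : BoundedTableau (n + 1) (colShape c))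
    (h : colShape (removeStrip c (topColumns n c T.1)) ≤ colShape c) :
    ∀ p ∈ (colShape (removeStrip c (topColumns n c T.1))).cells, T.1.restrict h p.1 p.2 < n := by
  intro p hp
  rw [SemistandardYoungTableau.restrict_apply, if_pos (show (p.1, p.2) ∈ colShape _ from hp)]
  obtain ⟨hk, hp'⟩ := (mem_colShape (isStrip_topColumns hc T).2).1 hp
  exact (lt_iff_lt_removeStrip hc T (j := ⟨p.2, hk⟩) (hp'.trans_le (removeStrip_le _ _ _))).2 hp'

/-- Tableaux are grouped by the columns containing `n`; deleting these cells and refilling them are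
inverse bijections. -/
theorem boundedSchur_succ (hc : Antitone c) [DecidablePred (IsStrip c)] :
    boundedSchur (n + 1) (colShape c) = ∑ s : Finset (Fin k),
      if IsStrip c s then MvPowerSeries.X n ^ s.card * boundedSchur n (colShape (removeStrip c s))
      else 0 := by
  rw [boundedSchur, ← sum_fiberwise (g := fun T => topColumns n c T.1)]
  refine sum_congr rfl fun s _ => ?_
  split_ifs with hs
  · rw [boundedSchur, mul_sum]
    symm
    refine sum_bij' (fun T _ => T.extend hc hs)
      (fun T hT => ⟨T.1.restrict (removeStrip_le_colShape hc hs.2), ?_⟩) ?_ ?_ ?_ ?_ ?_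
    · obtain ⟨-, rfl⟩ := mem_filter.1 hT
      exact T.restrict_lt hc _
    · intro T _
      exact mem_filter.2 ⟨mem_univ _, T.topColumns_extend hc hs⟩
    · intro T _
      exact mem_univ _
    · intro T _
      refine Subtype.ext <| SemistandardYoungTableau.ext fun i j => ?_
      rw [SemistandardYoungTableau.restrict_apply, BoundedTableau.extend_apply]
      split_ifs with h
      · rfl
      · exact (T.1.zeros h).symm
    · intro T hT
      obtain ⟨-, rfl⟩ := mem_filter.1 hT
      refine Subtype.ext <| SemistandardYoungTableau.ext fun i j => ?_
      rw [BoundedTableau.extend_apply]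
      split_ifs with h h'
      · exact if_pos h
      · obtain ⟨hk, hp⟩ := (mem_colShape hc).1 h'
        have h1 := T.lt_succ hc (j := ⟨j, hk⟩) hp
        have h2 := lt_iff_lt_removeStrip hc T (j := ⟨j, hk⟩) hp
        rw [← mk_mem_colShape hs.2] at h2
        have h3 := mt h2.1 h
        change n = T.1 i (Fin.mk j hk : Fin k)
        lia
      · exact (T.1.zeros h').symm
    · intro T _
      rw [T.type_extend hc hs, MvPowerSeries.X_pow_eq, MvPowerSeries.monomial_mul_monomial, one_mul]
  · refine sum_eq_zero fun T hT => ?_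
    obtain ⟨-, rfl⟩ := mem_filter.1 hT
    exact (hs (isStrip_topColumns hc T)).elim

/-- Both sides obey the same recursion in `n`, once the determinants for sets `s` that are not
strips are seen to vanish. -/
theorem boundedSchur_colShape (n : ℕ) {c : Fin k → ℕ} (hc : Antitone c) :
    boundedSchur n (colShape c) = jacobiTrudi n (fun j => (c j : ℤ)) := by
  classical
  induction n generalizing c with
  | zero => rw [boundedSchur_zero hc, jacobiTrudi_zero hc]
  | succ n ih =>
    have hc' : Antitone fun j => (c j : ℤ) := fun _ _ h => Int.ofNat_le.2 (hc h)
    rw [boundedSchur_succ hc, jacobiTrudi_succ]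
    refine sum_congr rfl fun s _ => ?_
    split_ifs with hs
    · rw [ih hs.2]
      congr 2
      ext1 j
      have := hs.1 j
      rw [removeStrip, Nat.cast_sub]
      unfold stripIndicator
      split_ifs with h
      · exact this h
      · exact Nat.zero_le _
    · symm
      -- A set that is not a strip breaks monotonicity or makes a length negative. Integer
      -- subtraction is needed to see the latter, since `removeStrip` truncates.
      by_cases ha : Antitone fun j => (c j : ℤ) - stripIndicator s j
      · by_cases hneg : ∃ j, (c j : ℤ) - stripIndicator s j < 0
        · obtain ⟨j, hj⟩ := hneg
          rw [jacobiTrudi_eq_zero_of_neg n ha hj, mul_zero]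
        · push Not at hneg
          refine (hs ⟨fun j hj => ?_, fun i j h => ?_⟩).elim
          · have := hneg j
            simp only [stripIndicator, if_pos hj] at this
            lia
          · have := ha h
            have h1 := hneg i
            have h2 := hneg j
            simp only [removeStrip] at this ⊢
            lia
      · rw [jacobiTrudi_eq_zero_of_not_antitone n hc' ha, mul_zero]

end Branching

/-! ### Passage to infinitely many variables and the explicit Schur expansions -/

section SchurExpansion

open Finset

/-- The two series have the same coefficients at the monomials in `x 0, …, x (n - 1)`. -/
def AgreeBelow (n : ℕ) (f g : MvPowerSeries ℕ ℤ) : Prop :=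
  ∀ d : ℕ →₀ ℕ, (∀ t ∈ d.support, t < n) → MvPowerSeries.coeff d f = MvPowerSeries.coeff d g

namespace AgreeBelow

variable {n : ℕ} {f f' g g' : MvPowerSeries ℕ ℤ}

theorem add (hf : AgreeBelow n f f') (hg : AgreeBelow n g g') : AgreeBelow n (f + g) (f' + g') :=
  fun d hd => by rw [map_add, map_add, hf d hd, hg d hd]

theorem sub (hf : AgreeBelow n f f') (hg : AgreeBelow n g g') : AgreeBelow n (f - g) (f' - g') :=
  fun d hd => by rw [map_sub, map_sub, hf d hd, hg d hd]

theorem mul (hf : AgreeBelow n f f') (hg : AgreeBelow n g g') : AgreeBelow n (f * g) (f' * g') :=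
  fun d hd => by
    classical
    rw [MvPowerSeries.coeff_mul, MvPowerSeries.coeff_mul]
    refine sum_congr rfl fun p hp => ?_
    rw [HasAntidiagonal.mem_antidiagonal] at hp
    rw [hf p.1 fun t ht => hd t ?_, hg p.2 fun t ht => hd t ?_]
    all_goals
      rw [← hp]
      simp only [Finsupp.mem_support_iff, Finsupp.add_apply] at ht ⊢
      lia

theorem sum {ι : Type*} {s : Finset ι} {F F' : ι → MvPowerSeries ℕ ℤ}
    (h : ∀ a ∈ s, AgreeBelow n (F a) (F' a)) : AgreeBelow n (∑ a ∈ s, F a) (∑ a ∈ s, F' a) :=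
  fun d hd => by rw [map_sum, map_sum, sum_congr rfl fun a ha => h a ha d hd]

/-- Each monomial involves finitely many variables, so its coefficient is seen at some finite `n`.
-/
theorem eq_of_forall {G : ℕ → MvPowerSeries ℕ ℤ} (hf : ∀ n, AgreeBelow n f (G n))
    (hg : ∀ n, AgreeBelow n g (G n)) : f = g := by
  ext d
  have hd : ∀ t ∈ d.support, t < d.support.sup id + 1 := fun t ht =>
    Nat.lt_succ_of_le (le_sup (f := id) ht)
  rw [hf _ d hd, hg _ d hd]

end AgreeBelow

theorem agreeBelow_schurFunction_colShape (n : ℕ) {k : ℕ} {c : Fin k → ℕ} (hc : Antitone c) :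
    AgreeBelow n (schurFunction (colShape c)) (jacobiTrudi n fun j => (c j : ℤ)) := fun d hd => by
  rw [← boundedSchur_colShape n hc, coeff_boundedSchur _ hd]

theorem antitone_vec_two {a b : ℕ} (h : b ≤ a) : Antitone ![a, b] := by
  rw [Fin.antitone_iff_succ_le]
  intro i
  fin_cases i
  simpa using h

theorem antitone_vec_four {a b c d : ℕ} (h₁ : b ≤ a) (h₂ : c ≤ b) (h₃ : d ≤ c) :
    Antitone ![a, b, c, d] := by
  rw [Fin.antitone_iff_succ_le]
  intro i
  fin_cases i <;> simpa

theorem twoColumnShape_eq_colShape (a b : ℕ) : twoColumnShape a b = colShape ![a + b, a] := by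
  ext ⟨i, j⟩
  rw [YoungDiagram.mem_cells, YoungDiagram.mem_cells, mem_colShape (antitone_vec_two (by lia)),
    twoColumnShape, YoungDiagram.mem_ofRowLens]
  simp only [List.length_append, List.length_replicate, List.getElem_append, List.getElem_replicate]
  match j with
  | 0 => simp; grind
  | 1 => simp; grind
  | j + 2 => simp; grind

theorem agreeBelow_schurTwoColumn (n : ℕ) (a : ℤ) (b : ℕ) (ha : -1 ≤ a) :
    AgreeBelow n (schurTwoColumn a b) (minorTwo (elemSymm n) (a + b) a) := by
  rw [schurTwoColumn]
  split_ifs with h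
  · lift a to ℕ using h
    have := agreeBelow_schurFunction_colShape n (antitone_vec_two (Nat.le_add_right a b))
    rw [← twoColumnShape_eq_colShape] at this
    convert this using 1
    · rfl
    · simp [jacobiTrudi, Matrix.det_fin_two, minorTwo, sub_eq_add_neg]
  -- For negative `a` the determinant vanishes by itself, in accordance with the convention.
  · rw [minorTwo, elemSymm_of_neg n a (by lia), elemSymm_of_neg n (a - 1) (by lia), mul_zero,
      mul_zero, sub_zero]
    exact fun _ _ => rfl

theorem agreeBelow_schurFunction_four (n : ℕ) {a b c d : ℕ} (h₁ : b ≤ a) (h₂ : c ≤ b)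
    (h₃ : d ≤ c) :
    AgreeBelow n (schurFunction (colShape ![a, b, c, d])) (minorFour (elemSymm n) a b c d) := by
  convert agreeBelow_schurFunction_colShape n (antitone_vec_four h₁ h₂ h₃) using 1
  rw [minorFour, jacobiTrudi]
  congr 1
  ext1 i j
  fin_cases i <;> fin_cases j <;> simp <;> congr 1 <;> ring

theorem agreeBelow_schurD (n i j : ℕ) :
    AgreeBelow n (schurD (i + j + 1) i) (minorD (elemSymm n) i j) := by
  have hj : ((i + j + 1 : ℕ) : ℤ) - i - 1 = j := by push_cast; ring
  rw [schurD, hj, minorD]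
  refine .sub (.add (.mul ?_ ?_) (.mul ?_ ?_)) (.mul ?_ ?_)
  · simpa using agreeBelow_schurTwoColumn n i 0 (by lia)
  · simpa using agreeBelow_schurTwoColumn n j 0 (by lia)
  · convert agreeBelow_schurTwoColumn n ((i : ℤ) - 1) 2 (by lia) using 2
    push_cast; ring
  · simpa using agreeBelow_schurTwoColumn n j 0 (by lia)
  · convert agreeBelow_schurTwoColumn n ((i : ℤ) - 1) 1 (by lia) using 2
    push_cast; ring
  · simpa using agreeBelow_schurTwoColumn n j 1 (by lia)

/-- For `i ≤ j`, an explicit multiplicity-free Schur expansion of `schurD (i + j + 1) i`. -/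
theorem schurD_eq_sum {i j : ℕ} (h : i ≤ j) :
    schurD (i + j + 1) i =
      ∑ a ∈ range (i + 1), schurFunction (colShape ![j + a, j, i, i - a])
      + ∑ a ∈ range i,
          if i < j then schurFunction (colShape ![j + a, j, i + 1, i - 1 - a]) else 0 := by
  refine AgreeBelow.eq_of_forall (fun n => agreeBelow_schurD n i j) fun n => ?_
  rw [minorD_eq_sum (elemSymm_of_neg n)]
  refine .add (.sum fun a ha => ?_) (.sum fun a ha => ?_)
  · rw [mem_range] at ha
    have := agreeBelow_schurFunction_four n (Nat.le_add_right j a) h (Nat.sub_le i a)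
    rwa [Nat.cast_sub (by lia), Nat.cast_add] at this
  · rw [mem_range] at ha
    split_ifs with hij
    · have := agreeBelow_schurFunction_four n (Nat.le_add_right j a) (show i + 1 ≤ j by lia)
        (show i - 1 - a ≤ i + 1 by lia)
      rwa [Nat.cast_sub (by lia), Nat.cast_sub (by lia), Nat.cast_add, Nat.cast_add,
        Nat.cast_one] at this
    · obtain rfl : i = j := by lia
      rw [minorFour_self_succ]
      exact fun _ _ => rfl

/-- For `j < i`, an explicit multiplicity-free Schur expansion of `-schurD (i + j + 1) i`. -/
theorem neg_schurD_eq_sum {i j : ℕ} (h : j < i) :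
    -schurD (i + j + 1) i =
      ∑ b ∈ range (j + 1),
          (if j + 1 < i then schurFunction (colShape ![i + b, i - 1, j + 1, j - b]) else 0)
      + ∑ b ∈ range j, schurFunction (colShape ![i + b, i, j + 1, j - 1 - b]) := by
  refine AgreeBelow.eq_of_forall (G := fun n => -minorD (elemSymm n) i j) (fun n d hd => ?_)
    fun n => ?_
  · rw [map_neg, map_neg, agreeBelow_schurD n i j d hd]
  rw [neg_minorD_eq_sum (elemSymm_of_neg n)]
  refine .add (.sum fun b hb => ?_) (.sum fun b hb => ?_)
  · rw [mem_range] at hb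
    split_ifs with hij
    · have := agreeBelow_schurFunction_four n (show i - 1 ≤ i + b by lia)
        (show j + 1 ≤ i - 1 by lia) (show j - b ≤ j + 1 by lia)
      rwa [Nat.cast_sub (by lia), Nat.cast_sub (by lia), Nat.cast_add, Nat.cast_add,
        Nat.cast_one] at this
    · obtain rfl : i = j + 1 := by lia
      have := minorFour_self_succ (elemSymm n) ((j + 1 : ℕ) + b) j (j - b)
      rw [Nat.cast_succ] at this ⊢
      rw [add_sub_cancel_right, this]
      exact fun _ _ => rfl
  · rw [mem_range] at hb
    have := agreeBelow_schurFunction_four n (Nat.le_add_right i b) (show j + 1 ≤ i by lia)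
      (show j - 1 - b ≤ j + 1 by lia)
    rwa [Nat.cast_sub (by lia), Nat.cast_sub (by lia), Nat.cast_add, Nat.cast_add,
      Nat.cast_one] at this

theorem isSchurPositive_zero : IsSchurPositive 0 :=
  ⟨0, by simp [IsSchurExpansion], fun _ => le_rfl⟩

theorem isSchurPositive_schurFunction (μ : YoungDiagram) : IsSchurPositive (schurFunction μ) := by
  classical
  refine ⟨Finsupp.single μ 1, by simp [IsSchurExpansion], fun ν => ?_⟩
  rw [Finsupp.single_apply]
  split_ifs <;> simp

theorem IsSchurPositive.add {f g : MvPowerSeries ℕ ℤ} (hf : IsSchurPositive f)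
    (hg : IsSchurPositive g) : IsSchurPositive (f + g) := by
  obtain ⟨a, ha, ha'⟩ := hf
  obtain ⟨b, hb, hb'⟩ := hg
  refine ⟨a + b, ?_, fun μ => add_nonneg (ha' μ) (hb' μ)⟩
  rw [IsSchurExpansion] at *
  rw [Finsupp.sum_add_index' (by simp) (by intros; rw [add_smul]), ← ha, ← hb]

theorem IsSchurPositive.sum {ι : Type*} {s : Finset ι} {F : ι → MvPowerSeries ℕ ℤ}
    (h : ∀ a ∈ s, IsSchurPositive (F a)) : IsSchurPositive (∑ a ∈ s, F a) :=
  sum_induction F IsSchurPositive (fun _ _ => .add) isSchurPositive_zero h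

theorem IsSchurPositive.isSchurNegative_of_neg {f : MvPowerSeries ℕ ℤ} (h : IsSchurPositive (-f)) :
    IsSchurNegative f := by
  obtain ⟨a, ha, ha'⟩ := h
  refine ⟨-a, ?_, fun μ => neg_nonpos.2 (ha' μ)⟩
  rw [IsSchurExpansion] at *
  rw [Finsupp.sum_neg_index (by simp)]
  simp only [neg_smul]
  rw [Finsupp.sum_neg, ← ha, neg_neg]

theorem isSchurPositive_schurD {i j : ℕ} (h : i ≤ j) : IsSchurPositive (schurD (i + j + 1) i) := by
  rw [schurD_eq_sum h]
  refine .add (.sum fun a _ => isSchurPositive_schurFunction _) (.sum fun a _ => ?_)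
  split_ifs
  · exact isSchurPositive_schurFunction _
  · exact isSchurPositive_zero

theorem isSchurNegative_schurD {i j : ℕ} (h : j < i) : IsSchurNegative (schurD (i + j + 1) i) := by
  apply IsSchurPositive.isSchurNegative_of_neg
  rw [neg_schurD_eq_sum h]
  refine .add (.sum fun a _ => ?_) (.sum fun a _ => isSchurPositive_schurFunction _)
  split_ifs
  · exact isSchurPositive_schurFunction _
  · exact isSchurPositive_zero

end SchurExpansion

theorem mainTheorem10 (k : ℕ) (hk : 1 ≤ k) :
    (∀ m : ℕ, m = 2 * k + 1 →
      (∀ i : ℕ, i ≤ k → IsSchurPositive (schurD m i)) ∧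
      (∀ i : ℕ, k + 1 ≤ i → i ≤ m - 1 → IsSchurNegative (schurD m i))) ∧
    (∀ m : ℕ, m = 2 * k →
      (∀ i : ℕ, i ≤ k - 1 → IsSchurPositive (schurD m i)) ∧
      (∀ i : ℕ, k ≤ i → i ≤ m - 1 → IsSchurNegative (schurD m i))) := by
  -- With j = m - i - 1, the condition i ≤ j reads 2i + 1 ≤ m; the two parities of m only round this
  -- threshold.
  have pos : ∀ m i : ℕ, 2 * i + 1 ≤ m → IsSchurPositive (schurD m i) := fun m i h => by
    have := isSchurPositive_schurD (i := i) (j := m - i - 1) (by lia)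
    rwa [show i + (m - i - 1) + 1 = m by lia] at this
  have neg : ∀ m i : ℕ, m ≤ 2 * i → i + 1 ≤ m → IsSchurNegative (schurD m i) := fun m i h h' => by
    have := isSchurNegative_schurD (i := i) (j := m - i - 1) (by lia)
    rwa [show i + (m - i - 1) + 1 = m by lia] at this
  exact ⟨fun m hm => ⟨fun i hi => pos m i (by lia), fun i hi hi' => neg m i (by lia) (by lia)⟩,
    fun m hm => ⟨fun i hi => pos m i (by lia), fun i hi hi' => neg m i (by lia) (by lia)⟩⟩
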